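/- Let $n\ge 0$ and let $X\subseteq\mathbb Z^n$ be a digital image with $c_1$-adjacency: two points are adjacent if and only if they differ by $1$ in exactly one coordinate and agree in all others. For $x\in X$ let $\overline N^X_{c_1}(x)$ be the set of $y\in X$ that are equal or adjacent to $x$. For $A\subseteq X$ put $\mathrm{Int}(A)=\{x\in A : \overline N^X_{c_1}(x)\subseteq A\}$, $\mathrm{Int}^0(A)=A$ and $\mathrm{Int}^i(A)=\mathrm{Int}(\mathrm{Int}^{i-1}(A))$ for $i\ge 1$. An elementary $q$-cube is a product $Q=J_1\times\cdots\times J_n$ of sets $J_j=\{a_j\}$ or $J_j=\{a_j,a_j+1\}$ with $a_j\in\mathbb Z$, exactly $q$ of them (those with indices $j_1<\cdots<j_q$) having two elements. Let $C_q^{c_1}(X)$ be the free abelian group on the elementary $q$-cubes contained in $X$ (so it is $0$ for $q<0$), with boundary $\partial Q=\sum_{k=1}^q(-1)^k(A_{j_k}Q-B_{j_k}Q)$, where $A_jQ$ and $B_jQ$ are obtained from $Q$ by replacing $J_j$ by $\{\min J_j\}$ and $\{\max J_j\}$ respectively. For $A\subseteq X$ let $H_q^{c_1}(X,A)$ be the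 $q$-th homology group of the quotient chain complex $C_*^{c_1}(X)/C_*^{c_1}(A)$. Let $A,B\subseteq X$ and suppose that $X=\mathrm{Int}^i(A)\cup\mathrm{Int}^i(B)$ for some positive integer $i$. Then for every integer $q<i+1$ $$H_q^{c_1}(X,A)\cong H_q^{c_1}(B,A\cap B),$$ and the isomorphism can be taken to be the inverse of the homomorphism $H_q^{c_1}(B,A\cap B)\to H_q^{c_1}(X,A)$ induced by the inclusion $(B,A\cap B)\subseteq(X,A)$. -/

import Mathlib

open CategoryTheory

noncomputable section

namespace Digital

/-- `c₁`-adjacency on `ℤⁿ`: the points differ by `1` in one coordinate and agree in all others. -/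
def Adj {n : ℕ} (x y : Fin n → ℤ) : Prop :=
  ∃ j, |x j - y j| = 1 ∧ ∀ k, k ≠ j → x k = y k

/-- The closed `c₁`-neighbourhood of `x` in the digital image `X`. -/
def closedNbhd {n : ℕ} (X : Set (Fin n → ℤ)) (x : Fin n → ℤ) : Set (Fin n → ℤ) :=
  {y | y ∈ X ∧ (Adj x y ∨ x = y)}

/-- The interior of a subset `A` of the digital image `X`. -/
def dInt {n : ℕ} (X A : Set (Fin n → ℤ)) : Set (Fin n → ℤ) :=
  {x | x ∈ A ∧ closedNbhd X x ⊆ A}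

/-- The iterated interior `Intⁱ(A)` of a subset `A` of the digital image `X`. -/
def dIntIter {n : ℕ} (X A : Set (Fin n → ℤ)) : ℕ → Set (Fin n → ℤ)
  | 0 => A
  | i + 1 => dInt X (dIntIter X A i)

/-- An elementary cube `J₁ × ⋯ × Jₙ` in `ℤⁿ`, recorded by its lowest corner and the set of
coordinates in which the elementary interval is nondegenerate. -/
@[ext] structure ElemCube (n : ℕ) where
  lo : Fin n → ℤ
  nondeg : Finset (Fin n)

namespace ElemCube

variable {n : ℕ}

/-- `max J_j`. -/
def hi (Q : ElemCube n) (j : Fin n) : ℤ :=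
  if j ∈ Q.nondeg then Q.lo j + 1 else Q.lo j

/-- The set of points of the cube: the product of the elementary intervals
`J_j = {min J_j, …, max J_j}`. -/
def toSet (Q : ElemCube n) : Set (Fin n → ℤ) :=
  Set.univ.pi fun j => Set.Icc (Q.lo j) (Q.hi j)

/-- The dimension: the number of nondegenerate intervals. -/
def dim (Q : ElemCube n) : ℕ := Q.nondeg.card

/-- The front face: replace `J_j` by `[min J_j]`. -/
def front (Q : ElemCube n) (j : Fin n) : ElemCube n :=
  ⟨Q.lo, Q.nondeg.erase j⟩

/-- The back face: replace `J_j` by `[max J_j]`. -/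
def back (Q : ElemCube n) (j : Fin n) : ElemCube n :=
  ⟨Function.update Q.lo j (Q.hi j), Q.nondeg.erase j⟩

/-- The position (counted from `1`) of `j` in the increasing list `j₁ < ⋯ < j_q` of nondegenerate
coordinates of the cube. -/
def pos (Q : ElemCube n) (j : Fin n) : ℕ := (Q.nondeg.filter (· ≤ j)).card

end ElemCube

/-- `∂Q = ∑ᵢ (-1)ⁱ (A_{jᵢ} Q - B_{jᵢ} Q)`, where `j₁ < ⋯ < j_q` are the nondegenerate
coordinates of `Q`. -/
def bdryCube {n : ℕ} (Q : ElemCube n) : ElemCube n →₀ ℤ :=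
  ∑ j ∈ Q.nondeg, (-1 : ℤ) ^ Q.pos j •
    (Finsupp.single (Q.front j) 1 - Finsupp.single (Q.back j) 1)

/-- The linear extension of the boundary to the free abelian group on all elementary cubes. -/
def bdry (n : ℕ) : (ElemCube n →₀ ℤ) →ₗ[ℤ] (ElemCube n →₀ ℤ) :=
  Finsupp.linearCombination ℤ bdryCube

/-- The group `C_q^{c₁}(X)`: the free abelian group on the elementary `q`-cubes contained in `X`,
realised as the finitely supported integral combinations of such cubes. It is zero for `q < 0`. -/
def chains {n : ℕ} (X : Set (Fin n → ℤ)) (q : ℤ) : Submodule ℤ (ElemCube n →₀ ℤ) :=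
  Finsupp.supported ℤ ℤ {Q | (Q.dim : ℤ) = q ∧ Q.toSet ⊆ X}

section Facts

variable {n : ℕ}

lemma bdry_single (Q : ElemCube n) (c : ℤ) : bdry n (Finsupp.single Q c) = c • bdryCube Q := by
  simp [bdry]

lemma chains_mono {X Y : Set (Fin n → ℤ)} (h : X ⊆ Y) (q : ℤ) : chains X q ≤ chains Y q :=
  Finsupp.supported_mono fun _ hQ => ⟨hQ.1, hQ.2.trans h⟩

lemma front_toSet (Q : ElemCube n) (j : Fin n) : (Q.front j).toSet ⊆ Q.toSet := by
  intro x hx k _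
  have := hx k trivial
  simp only [ElemCube.front, ElemCube.hi, Finset.mem_erase, Set.mem_Icc] at this ⊢
  split_ifs at * <;> first | omega | simp_all

lemma back_toSet (Q : ElemCube n) (j : Fin n) : (Q.back j).toSet ⊆ Q.toSet := by
  intro x hx k _
  have := hx k trivial
  by_cases hk : k = j
  · subst hk
    simp only [ElemCube.back, ElemCube.hi, Finset.mem_erase, Set.mem_Icc, Function.update_self,
      ne_eq, not_true_eq_false, false_and, if_false] at this ⊢
    split_ifs at * <;> omega
  · simpa [ElemCube.back, ElemCube.hi, Function.update_of_ne hk, hk] using this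

lemma bdry_mem {X : Set (Fin n → ℤ)} {q : ℤ} {c : ElemCube n →₀ ℤ} (hc : c ∈ chains X (q + 1)) :
    bdry n c ∈ chains X q := by
  rw [bdry, Finsupp.linearCombination_apply]
  refine Submodule.sum_mem _ fun Q hQ => Submodule.smul_mem _ _ ?_
  obtain ⟨hd, hX⟩ := (Finsupp.mem_supported ℤ c).1 hc hQ
  refine Submodule.sum_mem _ fun j hj => Submodule.smul_mem _ _ ?_
  have hcard : ((Q.nondeg.erase j).card : ℤ) = q := by
    have := Finset.card_erase_add_one hj
    simp only [ElemCube.dim] at hd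
    omega
  exact Submodule.sub_mem _
    (Finsupp.single_mem_supported ℤ _ ⟨hcard, (front_toSet Q j).trans hX⟩)
    (Finsupp.single_mem_supported ℤ _ ⟨hcard, (back_toSet Q j).trans hX⟩)

lemma pos_mul (s : Finset (Fin n)) {j k : Fin n} (hj : j ∈ s) (hjk : j < k) :
    (-1 : ℤ) ^ (s.filter (· ≤ j)).card * (-1) ^ ((s.erase j).filter (· ≤ k)).card +
      (-1) ^ (s.filter (· ≤ k)).card * (-1) ^ ((s.erase k).filter (· ≤ j)).card = 0 := by
  have h1 : (s.erase k).filter (· ≤ j) = s.filter (· ≤ j) := by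
    ext x
    simp only [Finset.mem_filter, Finset.mem_erase]
    constructor
    · rintro ⟨⟨_, h⟩, h'⟩; exact ⟨h, h'⟩
    · rintro ⟨h, h'⟩; exact ⟨⟨(h'.trans_lt hjk).ne, h⟩, h'⟩
  have h2 : ((s.erase j).filter (· ≤ k)).card + 1 = (s.filter (· ≤ k)).card := by
    rw [Finset.filter_erase]
    exact Finset.card_erase_add_one (by simp [hj, hjk.le])
  rw [h1, ← h2, pow_succ]
  ring

lemma bdry_bdryCube (Q : ElemCube n) : bdry n (bdryCube Q) = 0 := by
  have key : bdry n (bdryCube Q) = ∑ p ∈ Q.nondeg.sigma fun j => Q.nondeg.erase j,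
      ((-1 : ℤ) ^ Q.pos p.1 * (-1) ^ ((Q.nondeg.erase p.1).filter (· ≤ p.2)).card) •
      ((Finsupp.single ((Q.front p.1).front p.2) 1 - Finsupp.single ((Q.front p.1).back p.2) 1) -
       (Finsupp.single ((Q.back p.1).front p.2) 1 - Finsupp.single ((Q.back p.1).back p.2) 1)) := by
    rw [Finset.sum_sigma]
    simp only [bdryCube, map_sum, map_smul, map_sub, bdry_single, one_smul]
    refine Finset.sum_congr rfl fun j _ => ?_
    simp only [mul_smul, smul_sub (_ : ℤ) (_ - _) (_ - _), ← Finset.smul_sum,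
      Finset.sum_sub_distrib]
    rw [← smul_sub]
    rfl
  rw [key]
  refine Finset.sum_involution (fun p _ => ⟨p.2, p.1⟩) ?_ ?_ ?_ ?_
  · rintro ⟨j, k⟩ hp
    simp only [Finset.mem_sigma, Finset.mem_erase] at hp
    obtain ⟨hj, hne, hk⟩ := hp
    have e1 : (Q.front j).front k = (Q.front k).front j := by
      simp [ElemCube.front, Finset.erase_right_comm]
    have e2 : (Q.front j).back k = (Q.back k).front j := by
      simp [ElemCube.front, ElemCube.back, ElemCube.hi, Finset.erase_right_comm, hne]
    have e3 : (Q.back j).front k = (Q.front k).back j := by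
      simp [ElemCube.front, ElemCube.back, ElemCube.hi, Finset.erase_right_comm, hne.symm]
    have e4 : (Q.back j).back k = (Q.back k).back j := by
      simp [ElemCube.back, ElemCube.hi, Finset.erase_right_comm, hne, hne.symm,
        Function.update_comm hne]
    have hs : ((-1 : ℤ) ^ Q.pos j * (-1) ^ ((Q.nondeg.erase j).filter (· ≤ k)).card) +
        ((-1 : ℤ) ^ Q.pos k * (-1) ^ ((Q.nondeg.erase k).filter (· ≤ j)).card) = 0 := by
      rcases lt_or_gt_of_ne hne with h | h
      · rw [add_comm]; exact pos_mul _ hk h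
      · exact pos_mul _ hj h
    simp only [e1, e2, e3, e4]
    rw [eq_neg_of_add_eq_zero_left hs]
    module
  · rintro ⟨j, k⟩ hp _ h
    simp only [Finset.mem_sigma, Finset.mem_erase] at hp
    simp only [Sigma.mk.injEq, heq_eq_eq] at h
    exact hp.2.1 h.1
  · rintro ⟨j, k⟩ hp
    simp only [Finset.mem_sigma, Finset.mem_erase] at hp ⊢
    exact ⟨hp.2.2, hp.2.1.symm, hp.1⟩
  · rintro ⟨j, k⟩ _; rfl

lemma bdry_bdry (c : ElemCube n →₀ ℤ) : bdry n (bdry n c) = 0 := by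
  induction c using Finsupp.induction_linear with
  | zero => simp
  | add f g hf hg => simp [hf, hg]
  | single Q a => rw [bdry_single, map_smul, bdry_bdryCube, smul_zero]

end Facts

/-- The boundary operator `C_{q+1}^{c₁}(X) → C_q^{c₁}(X)`. -/
def bdryChains {n : ℕ} (X : Set (Fin n → ℤ)) (q : ℤ) : chains X (q + 1) →ₗ[ℤ] chains X q :=
  (bdry n).restrict fun _ hc => bdry_mem hc

/-- The relative chain group `C_q^{c₁}(X, A) = C_q^{c₁}(X) / C_q^{c₁}(A)`, for `A ⊆ X`. -/
abbrev RelChains {n : ℕ} (X A : Set (Fin n → ℤ)) (q : ℤ) : Type :=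
  chains X q ⧸ (chains A q).submoduleOf (chains X q)

/-- The boundary operator induced on relative chains. -/
def relBdry {n : ℕ} (X A : Set (Fin n → ℤ)) (q : ℤ) :
    RelChains X A (q + 1) →ₗ[ℤ] RelChains X A q :=
  Submodule.mapQ _ _ (bdryChains X q) fun _ hc => bdry_mem hc

lemma relBdry_comp {n : ℕ} (X A : Set (Fin n → ℤ)) (q : ℤ) :
    relBdry X A q ∘ₗ relBdry X A (q + 1) = 0 := by
  refine Submodule.linearMap_qext _ (LinearMap.ext fun c => ?_)
  have h : bdryChains X q (bdryChains X (q + 1) c) = 0 := Subtype.ext (bdry_bdry c.1)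
  change Submodule.Quotient.mk (bdryChains X q (bdryChains X (q + 1) c)) = 0
  rw [h, Submodule.Quotient.mk_zero]

/-- The relative `c₁`-cubical chain complex of the pair `(X, A)`. -/
def relComplex {n : ℕ} (X A : Set (Fin n → ℤ)) : ChainComplex (ModuleCat.{0} ℤ) ℤ :=
  ChainComplex.of (fun q => ModuleCat.of ℤ (RelChains X A q))
    (fun q => ModuleCat.ofHom (relBdry X A q))
    (fun q => by
      rw [← ModuleCat.ofHom_comp, relBdry_comp]
      rfl)

lemma relComplex_d {n : ℕ} (X A : Set (Fin n → ℤ)) (q : ℤ) :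
    (relComplex X A).d (q + 1) q = ModuleCat.ofHom (relBdry X A q) :=
  ChainComplex.of_d (fun q => ModuleCat.of ℤ (RelChains X A q)) (fun q => ModuleCat.ofHom (relBdry X A q)) q

/-- The relative `c₁`-cubical homology group `H_q^{c₁}(X, A)`. -/
def relHomology {n : ℕ} (X A : Set (Fin n → ℤ)) (q : ℤ) : ModuleCat.{0} ℤ :=
  (relComplex X A).homology q

/-- The map on relative chains induced by an inclusion of pairs `(Y, D) ⊆ (X, A)`. -/
def relChainsIncl {n : ℕ} {Y D X A : Set (Fin n → ℤ)} (hY : Y ⊆ X) (hD : D ⊆ A) (q : ℤ) :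
    RelChains Y D q →ₗ[ℤ] RelChains X A q :=
  Submodule.mapQ _ _ (Submodule.inclusion (chains_mono hY q)) fun _ hc => chains_mono hD q hc

/-- The chain map induced by an inclusion of pairs `(Y, D) ⊆ (X, A)`. -/
def relComplexIncl {n : ℕ} {Y D X A : Set (Fin n → ℤ)} (hY : Y ⊆ X) (hD : D ⊆ A) :
    relComplex Y D ⟶ relComplex X A :=
  ChainComplex.ofHom (fun q => ModuleCat.ofHom (relChainsIncl hY hD q))
    (fun q => by
      rw [relComplex_d, relComplex_d]
      refine ModuleCat.hom_ext ?_
      exact Submodule.linearMap_qext _ (LinearMap.ext fun c => rfl))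

/-- The homomorphism `H_q^{c₁}(Y, D) → H_q^{c₁}(X, A)` induced by an inclusion of pairs. -/
def relHomologyIncl {n : ℕ} {Y D X A : Set (Fin n → ℤ)} (hY : Y ⊆ X) (hD : D ⊆ A) (q : ℤ) :
    relHomology Y D q ⟶ relHomology X A q :=
  HomologicalComplex.homologyMap (relComplexIncl hY hD) q

end Digital

end

namespace Digital

variable {n : ℕ}

/-! Every elementary cube Q ⊆ X of dimension at most i + 1 lies in A or in B
(`cube_subset_or_subset`). Inside Q, distance is the number of differing coordinates, and a point of
Intⁱ(A) forces every vertex of Q within distance i into A (`mem_of_mem_dIntIter`). Vertices u ∉ A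
and v ∉ B must therefore be exactly i + 1 apart, and the covering fails at a neighbour of u on the
way to v. Hence C_p(X) = C_p(A) + C_p(B) for p ≤ i + 1, and the second isomorphism theorem gives
C_p(B)/C_p(A ∩ B) ≅ C_p(X)/C_p(A) (`relChainsIncl_bijective`). Homology in degree q sees only
degrees q - 1, q, q + 1, all at most i + 1. -/

lemma dIntIter_subset (X A : Set (Fin n → ℤ)) (i : ℕ) : dIntIter X A i ⊆ A := by
  induction i with
  | zero => exact subset_rfl
  | succ i ih => exact fun x hx => ih hx.1

/-! ### Distance between vertices of a cube, and iterated interiors -/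

/-- The set of coordinates in which two points differ. -/
def diffCoords (x y : Fin n → ℤ) : Finset (Fin n) := Finset.univ.filter fun j => x j ≠ y j

lemma mem_diffCoords {x y : Fin n → ℤ} {j : Fin n} : j ∈ diffCoords x y ↔ x j ≠ y j := by
  simp [diffCoords]

lemma diffCoords_eq_empty {x y : Fin n → ℤ} : diffCoords x y = ∅ ↔ x = y := by
  simp [diffCoords, Finset.filter_eq_empty_iff, funext_iff]

lemma diffCoords_comm (x y : Fin n → ℤ) : diffCoords x y = diffCoords y x := by
  ext j; simp [mem_diffCoords, ne_comm]

lemma diffCoords_update_left (x y : Fin n → ℤ) (j : Fin n) :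
    diffCoords (Function.update x j (y j)) y = (diffCoords x y).erase j := by
  ext k
  by_cases h : k = j
  · subst h; simp [mem_diffCoords]
  · simp [mem_diffCoords, h]

lemma diffCoords_update_self_subset (x : Fin n → ℤ) (j : Fin n) (a : ℤ) :
    diffCoords (Function.update x j a) x ⊆ {j} := by
  intro k hk
  by_contra h
  rw [Finset.mem_singleton] at h
  simp [mem_diffCoords, h] at hk

namespace ElemCube

lemma mem_Icc_of_mem_toSet {Q : ElemCube n} {x : Fin n → ℤ} (hx : x ∈ Q.toSet) (j : Fin n) :
    Q.lo j ≤ x j ∧ x j ≤ Q.hi j := hx j trivial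

/-- A cube is a product, so a path that replaces coordinates of x by those of y one at a time never
leaves it. -/
lemma update_mem_toSet {Q : ElemCube n} {x y : Fin n → ℤ} (hx : x ∈ Q.toSet) (hy : y ∈ Q.toSet)
    (j : Fin n) : Function.update x j (y j) ∈ Q.toSet := by
  intro k _
  by_cases h : k = j
  · subst h; simpa using hy k trivial
  · simpa [h] using hx k trivial

lemma diffCoords_subset_nondeg {Q : ElemCube n} {x y : Fin n → ℤ} (hx : x ∈ Q.toSet)
    (hy : y ∈ Q.toSet) : diffCoords x y ⊆ Q.nondeg := by
  intro j hj
  rw [mem_diffCoords] at hj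
  by_contra h
  have h1 := mem_Icc_of_mem_toSet hx j
  have h2 := mem_Icc_of_mem_toSet hy j
  simp only [hi, if_neg h] at h1 h2
  omega

lemma adj_update {Q : ElemCube n} {x y : Fin n → ℤ} (hx : x ∈ Q.toSet) (hy : y ∈ Q.toSet)
    {j : Fin n} (hj : x j ≠ y j) : Adj x (Function.update x j (y j)) := by
  refine ⟨j, ?_, fun k hk => by simp [hk]⟩
  have h1 := mem_Icc_of_mem_toSet hx j
  have h2 := mem_Icc_of_mem_toSet hy j
  have h3 : Q.hi j ≤ Q.lo j + 1 := by unfold hi; split_ifs <;> omega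
  rw [Function.update_self, abs_eq zero_le_one]
  omega

end ElemCube

/-- A vertex of a cube in `X` at distance at most `i` from a point of `Intⁱ(A)` lies in `A`. -/
lemma mem_of_mem_dIntIter {X A : Set (Fin n → ℤ)} {Q : ElemCube n} (hQ : Q.toSet ⊆ X) (i : ℕ)
    {x y : Fin n → ℤ} (hx : x ∈ Q.toSet) (hy : y ∈ Q.toSet) (hxA : x ∈ dIntIter X A i)
    (hxy : (diffCoords x y).card ≤ i) : y ∈ A := by
  induction i generalizing x with
  | zero =>
    rw [Nat.le_zero, Finset.card_eq_zero, diffCoords_eq_empty] at hxy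
    exact hxy ▸ hxA
  | succ i ih =>
    rcases (diffCoords x y).eq_empty_or_nonempty with h | ⟨j, hj⟩
    · exact diffCoords_eq_empty.1 h ▸ hxA |> dIntIter_subset X A (i + 1)
    -- One step towards y costs one layer of interior and removes one differing coordinate.
    · have hz := ElemCube.update_mem_toSet hx hy j
      refine ih hz (hxA.2 ⟨hQ hz, Or.inl (ElemCube.adj_update hx hy (mem_diffCoords.1 hj))⟩) ?_
      rw [diffCoords_update_left, Finset.card_erase_of_mem hj]
      omega

/-- If `X` is covered by the `i`-th interiors of `A` and `B`, where `i` is positive, then each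
elementary cube in `X` of dimension at most `i + 1` lies in `A` or in `B`. -/
lemma cube_subset_or_subset {X A B : Set (Fin n → ℤ)} {i : ℕ} (hi : 0 < i)
    (hX : X ⊆ dIntIter X A i ∪ dIntIter X B i) {Q : ElemCube n} (hQ : Q.toSet ⊆ X)
    (hdim : Q.dim ≤ i + 1) : Q.toSet ⊆ A ∨ Q.toSet ⊆ B := by
  by_contra! h
  obtain ⟨⟨u, hu, huA⟩, ⟨v, hv, hvB⟩⟩ := h.imp Set.not_subset.1 Set.not_subset.1
  have hvA : v ∈ dIntIter X A i :=
    (hX (hQ hv)).resolve_right fun h => hvB (dIntIter_subset X B i h)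
  have hlt : i < (diffCoords u v).card := by
    by_contra! hle
    exact huA (mem_of_mem_dIntIter hQ i hv hu hvA (diffCoords_comm u v ▸ hle))
  have hle : (diffCoords u v).card ≤ i + 1 :=
    (Finset.card_le_card (ElemCube.diffCoords_subset_nondeg hu hv)).trans hdim
  -- The point w, which is u with coordinate j taken from v, is at distance at most 1 ≤ i from u and
  -- at most i from v.
  obtain ⟨j, hj⟩ := Finset.card_pos.1 ((Nat.zero_le i).trans_lt hlt)
  have hw := ElemCube.update_mem_toSet hu hv j
  rcases hX (hQ hw) with hwA | hwB
  · refine huA (mem_of_mem_dIntIter hQ i hw hu hwA ?_)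
    exact (Finset.card_le_card (diffCoords_update_self_subset u j (v j))).trans
      (by rw [Finset.card_singleton]; exact hi)
  · refine hvB (mem_of_mem_dIntIter hQ i hw hv hwB ?_)
    rw [diffCoords_update_left, Finset.card_erase_of_mem hj]
    omega

/-! ### Relative chains and excision -/

lemma chains_inf (A B : Set (Fin n → ℤ)) (q : ℤ) :
    chains A q ⊓ chains B q = chains (A ∩ B) q := by
  rw [chains, chains, chains, ← Finsupp.supported_inter]
  congr 1
  ext Q
  simp only [Set.mem_inter_iff, Set.mem_ofPred_eq, Set.subset_inter_iff]
  tauto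

/-- Chains are supported on cubes, so sorting the cubes splits the chain. -/
lemma chains_le_sup {X A B : Set (Fin n → ℤ)} {q : ℤ}
    (h : ∀ Q : ElemCube n, (Q.dim : ℤ) = q → Q.toSet ⊆ X → Q.toSet ⊆ A ∨ Q.toSet ⊆ B) :
    chains X q ≤ chains A q ⊔ chains B q := by
  rw [chains, chains, chains, ← Finsupp.supported_union]
  exact Finsupp.supported_mono fun Q hQ =>
    (h Q hQ.1 hQ.2).imp (fun hA => ⟨hQ.1, hA⟩) fun hB => ⟨hQ.1, hB⟩

/-- The second isomorphism theorem for the relative chains of an excisive pair. -/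
lemma relChainsIncl_bijective {X A B : Set (Fin n → ℤ)} (hB : B ⊆ X) {q : ℤ}
    (h : ∀ Q : ElemCube n, (Q.dim : ℤ) = q → Q.toSet ⊆ X → Q.toSet ⊆ A ∨ Q.toSet ⊆ B) :
    Function.Bijective (relChainsIncl (Y := B) (D := A ∩ B) hB Set.inter_subset_left q) := by
  constructor
  · rw [injective_iff_map_eq_zero]
    intro c hc
    obtain ⟨c, rfl⟩ := Submodule.Quotient.mk_surjective _ c
    have hcA : c.1 ∈ chains A q := (Submodule.Quotient.mk_eq_zero
      ((chains A q).submoduleOf (chains X q)) (x := Submodule.inclusion (chains_mono hB q) c)).1 hc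
    refine (Submodule.Quotient.mk_eq_zero _).2 ?_
    change c.1 ∈ chains (A ∩ B) q
    exact chains_inf A B q ▸ ⟨hcA, c.2⟩
  · intro c
    obtain ⟨c, rfl⟩ := Submodule.Quotient.mk_surjective _ c
    obtain ⟨a, ha, b, hb, hab⟩ := Submodule.mem_sup.1 (chains_le_sup h c.2)
    -- With c = a + b, the part a vanishes modulo chains of A, so b represents the class of c.
    refine ⟨Submodule.Quotient.mk ⟨b, hb⟩, (Submodule.Quotient.eq _).2 ?_⟩
    change b - c.1 ∈ chains A q
    rw [← hab, sub_add_cancel_right]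
    exact Submodule.neg_mem _ ha

/-- Excision: the inclusion `(B, A ∩ B) ⊆ (X, A)` induces isomorphisms in homology in degrees below
`m` when each cube in `X` of dimension at most `m` lies in `A` or in `B`. -/
lemma isIso_relHomologyIncl {X A B : Set (Fin n → ℤ)} (hB : B ⊆ X) {m : ℤ}
    (h : ∀ Q : ElemCube n, (Q.dim : ℤ) ≤ m → Q.toSet ⊆ X → Q.toSet ⊆ A ∨ Q.toSet ⊆ B)
    {q : ℤ} (hq : q < m) :
    IsIso (relHomologyIncl (Y := B) (D := A ∩ B) hB Set.inter_subset_left q) := by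
  have hf : ∀ p ≤ m, IsIso
      ((relComplexIncl (Y := B) (D := A ∩ B) (X := X) (A := A) hB Set.inter_subset_left).f p) := by
    intro p hp
    rw [ConcreteCategory.isIso_iff_bijective]
    exact relChainsIncl_bijective hB fun Q hQ => h Q (hQ.trans_le hp)
  -- The strict bound q < m is needed here: boundaries come from degree q + 1.
  have h1 := hf ((ComplexShape.down ℤ).prev q) (by
    rw [ComplexShape.prev_eq' _ (show (ComplexShape.down ℤ).Rel (q + 1) q from rfl)]
    omega)
  have h2 := hf q hq.le
  have h3 := hf ((ComplexShape.down ℤ).next q) (by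
    rw [ComplexShape.next_eq' _ (show (ComplexShape.down ℤ).Rel q (q - 1) from by simp)]
    omega)
  exact ShortComplex.isIso_homologyMap_of_epi_of_isIso_of_mono'
    ((HomologicalComplex.shortComplexFunctor _ _ q).map
      (relComplexIncl (Y := B) (D := A ∩ B) (X := X) (A := A) hB Set.inter_subset_left))
    (inferInstanceAs (Epi ((relComplexIncl _ _).f _))) h2
    (inferInstanceAs (Mono ((relComplexIncl _ _).f _)))

end Digital

theorem mainTheorem10 {n : ℕ} (X A B : Set (Fin n → ℤ)) (hA : A ⊆ X) (hB : B ⊆ X)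
    (i : ℕ) (hi : 0 < i)
    (hX : X = Digital.dIntIter X A i ∪ Digital.dIntIter X B i)
    (q : ℤ) (hq : q < (i : ℤ) + 1) :
    ∃ e : Digital.relHomology X A q ≅ Digital.relHomology B (A ∩ B) q,
      e.inv = Digital.relHomologyIncl hB Set.inter_subset_left q := by
  have := Digital.isIso_relHomologyIncl hB
    (fun Q hdim hQ => Digital.cube_subset_or_subset hi hX.subset hQ (by exact_mod_cast hdim)) hq
  exact ⟨(asIso (Digital.relHomologyIncl hB Set.inter_subset_left q)).symm, rfl⟩
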